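/- Consider a finite-horizon multi-objective Markov game with finitely many agents $1,\dots,N$, a finite state space $\mathcal S$, finite nonempty action sets $\mathcal A_1,\dots,\mathcal A_N$ (with $\mathcal A=\prod_i\mathcal A_i$), horizon $H$, $M$ objectives per agent, transition kernels $P_h(\cdot\mid s,\mathbf a)\in\Delta(\mathcal S)$ and reward vectors $\mathbf r_{j,h}(s,\mathbf a)\in[0,1]^M$ for $1\le h\le H$, $s\in\mathcal S$, $\mathbf a\in\mathcal A$, $1\le j\le N$, and let $s_1\in\mathcal S$ be an initial state. A (stochastic Markov) policy of agent $k$ is a sequence $\pi_k=(\pi_{k,1},\dots,\pi_{k,H})$ of maps $\pi_{k,h}:\mathcal S\to\Delta(\mathcal A_k)$. Under a product policy $\boldsymbol\pi=(\pi_1,\dots,\pi_N)$ the agents randomize independently given the state and the step, and the value vector of agent $k$ is $$\mathbf V_{k,1}^{\boldsymbol\pi}(s_1)=\mathbb E_{\boldsymbol\pi,P}\Big[\sum_{h=1}^{H}\mathbf r_{k,h}(s_h,\mathbf a_h)\,\Big|\,s_1\Big]\in\mathbb R^M .$$ A vector $u\in\mathbb R^M$ Pareto dominates $v\in\mathbb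 R^M$ if $u_i\ge v_i$ for all $i$ and $u_j>v_j$ for some $j$. A product policy $\boldsymbol\pi^*$ is a Pareto-Nash equilibrium (PNE) if there are no agent $k$ and policy $\pi_k$ of agent $k$ such that $\mathbf V_{k,1}^{(\pi_k,\boldsymbol\pi^*_{-k})}(s_1)$ Pareto dominates $\mathbf V_{k,1}^{\boldsymbol\pi^*}(s_1)$. **Theorem (Existence of PNE).** Every finite multi-objective Markov game has a PNE in stochastic Markov policies. -/

import Mathlib

/-- A finite-horizon `N`-player general-sum multi-objective Markov game with state space `S`,
action spaces `A i`, horizon `H` and `M` objectives for each agent. The steps `1, …, H` are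
indexed by `Fin H`. `P h s a` is the law of the next state, and `r j h s a` is the reward vector
of agent `j`, when the joint action `a` is taken at state `s` and step `h`. -/
structure MOMG (N : ℕ) (S : Type*) [Fintype S] (A : Fin N → Type*) (H M : ℕ) where
  P : Fin H → S → (∀ i, A i) → stdSimplex ℝ S
  r : Fin N → Fin H → S → (∀ i, A i) → Fin M → ℝ
  r_mem : ∀ j h s a m, r j h s a m ∈ Set.Icc (0 : ℝ) 1

/-- A stochastic Markov policy for one agent with action space `B`: a decision rule
`S → Δ(B)` for every step. -/
abbrev MarkovPolicy (H : ℕ) (S : Type*) (B : Type*) [Fintype B] : Type _ :=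
  Fin H → S → stdSimplex ℝ B

/-- A profile of individual stochastic Markov policies, one for each agent. -/
abbrev PolicyProfile {N : ℕ} (H : ℕ) (S : Type*) (A : Fin N → Type*) [∀ i, Fintype (A i)] :
    Type _ :=
  ∀ i, MarkovPolicy H S (A i)

/-- The product joint policy induced by a profile: the agents randomize independently. -/
def PolicyProfile.joint {N H : ℕ} {S : Type*} {A : Fin N → Type*} [∀ i, Fintype (A i)]
    (π : PolicyProfile H S A) : MarkovPolicy H S (∀ i, A i) := fun h s =>
  ⟨fun a => ∏ i, (π i h s).1 (a i),
    fun a => Finset.prod_nonneg fun i _ => (π i h s).2.1 (a i), by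
      rw [← Fintype.prod_sum]
      exact Finset.prod_eq_one fun i _ => (π i h s).2.2⟩

namespace MOMG

variable {N : ℕ} {S : Type*} [Fintype S] {A : Fin N → Type*} [∀ i, Fintype (A i)] {H M : ℕ}

open Classical in
/-- The conditional law of the state at a given step, given the part of the trajectory
`τ = (s₁, a₁, …, s_H, a_H)` before that step: the point mass at `s₁` at the first step, and
`P_h(· | s_h, a_h)` at step `h + 1`. -/
noncomputable def stateLaw (G : MOMG N S A H M) (s₁ : S) (τ : Fin H → S × (∀ i, A i)) :
    Fin H → S → ℝ
  | ⟨0, _⟩ => Pi.single s₁ 1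
  | ⟨h + 1, hh⟩ =>
      (G.P ⟨h, Nat.lt_of_succ_lt hh⟩ (τ ⟨h, Nat.lt_of_succ_lt hh⟩).1
        (τ ⟨h, Nat.lt_of_succ_lt hh⟩).2).1

/-- The probability of the trajectory `τ` under the joint policy `π` from the initial state
`s₁`. -/
noncomputable def trajProb (G : MOMG N S A H M) (π : MarkovPolicy H S (∀ i, A i)) (s₁ : S)
    (τ : Fin H → S × (∀ i, A i)) : ℝ :=
  ∏ h, G.stateLaw s₁ τ h (τ h).1 * (π h (τ h).1).1 (τ h).2

/-- The value vector of agent `j`: the expectation over trajectories, under the joint policy `π`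
from the initial state `s₁`, of the cumulative reward in each of the `M` objectives. -/
noncomputable def value (G : MOMG N S A H M) (π : MarkovPolicy H S (∀ i, A i)) (j : Fin N)
    (s₁ : S) : Fin M → ℝ := fun m =>
  ∑ τ : Fin H → S × (∀ i, A i), G.trajProb π s₁ τ * ∑ h, G.r j h (τ h).1 (τ h).2 m

end MOMG

/-- `u` Pareto dominates `v`. -/
def ParetoDominates {M : ℕ} (u v : Fin M → ℝ) : Prop :=
  (∀ i, v i ≤ u i) ∧ ∃ j, v j < u j

/-- A profile `π` is a Pareto-Nash equilibrium from the initial state `s₁` if no agent `k` has a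
policy `π'` such that replacing `π k` by `π'` yields a value vector of `k` that Pareto dominates
the one under `π`. -/
def MOMG.IsPNE {N : ℕ} {S : Type*} [Fintype S] {A : Fin N → Type*} [∀ i, Fintype (A i)]
    {H M : ℕ} (G : MOMG N S A H M) (s₁ : S) (π : PolicyProfile H S A) : Prop :=
  ∀ k : Fin N, ¬ ∃ π' : MarkovPolicy H S (A k),
    ParetoDominates
      (G.value (PolicyProfile.joint (Function.update π k π')) k s₁)
      (G.value (PolicyProfile.joint π) k s₁)

/-! Scalarize with equal weights: a Pareto dominating value vector has a strictly larger coordinate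
sum, so a Nash equilibrium for the summed objectives (`totalValue`) is a PNE.

Such an equilibrium comes from backward induction (`MOMG.exists_totalValue_equilibrium`). Given an
equilibrium of the remaining steps from every state, let the agents play at each state a mixed
equilibrium of the one-shot game whose payoff is reward plus expected continuation (`stagePayoff`).
By the Bellman equation `totalValue_succ`, a deviation gains neither afterwards nor at the current
step.

Nash's theorem `exists_nashEquilibrium` follows from Brouwer's theorem for one simplex, carried over
to a product of simplices by a retraction. Brouwer's theorem rests on the parity argument of Scarf's
lemma `exists_isDominating_image_eq_univ`: applied to grid points ranked by their coordinates, it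
gives approximate fixed points, and compactness gives an exact one. -/

/-! ### Scarf's combinatorial lemma -/

section Scarf

variable {I X α : Type*} [LinearOrder α]

/-- A finite set `ρ` is dominating for the family `v` of rankings of `X` if no element of `X`
is above the minimum of `ρ` in every ranking. -/
def IsDominating (v : I → X → α) (ρ : Finset X) : Prop :=
  ∀ y, ∃ i, ∀ x ∈ ρ, v i y ≤ v i x

theorem IsDominating.mono {v : I → X → α} {ρ σ : Finset X} (h : IsDominating v σ)
    (hρ : ρ ⊆ σ) : IsDominating v ρ := fun y =>
  let ⟨i, hi⟩ := h y
  ⟨i, fun x hx => hi x (hρ hx)⟩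

variable [Fintype I] [DecidableEq I]

/-- In a dominating set with one element less than there are rankings, exactly two rankings
have the same minimum. -/
theorem IsDominating.exists_collision {v : I → X → α} (hv : ∀ i, Function.Injective (v i))
    {ρ : Finset X} (h : IsDominating v ρ) (hcard : ρ.card + 1 = Fintype.card I)
    {a : I → X} (ha : ∀ i, a i ∈ ρ) (hmin : ∀ i, ∀ x ∈ ρ, v i (a i) ≤ v i x) :
    ∃ i j, i ≠ j ∧ a i = a j ∧ (∀ x ∈ ρ, ∃ l, a l = x) ∧
      ∀ k l, k ≠ l → a k = a l → (k = i ∧ l = j) ∨ (k = j ∧ l = i) := by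
  have hsurj : ∀ x ∈ ρ, ∃ l, a l = x := fun x hx => by
    obtain ⟨l, hl⟩ := h x
    exact ⟨l, hv l (le_antisymm (hmin l x hx) (hl _ (ha l)))⟩
  obtain ⟨i, -, j, -, hij, haij⟩ := Finset.exists_ne_map_eq_of_card_lt_of_maps_to
    (s := (Finset.univ : Finset I)) (t := ρ) (f := a)
    (by rw [Finset.card_univ]; omega) (fun x _ => ha x)
  refine ⟨i, j, hij, haij, hsurj, ?_⟩
  -- Without `i` the map `a` is still onto `ρ`, because `j` takes over its value, and the
  -- cardinalities now agree.
  have hinj : Set.InjOn a (Finset.univ.erase i : Finset I) := by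
    apply Finset.injOn_of_surjOn_of_card_le (t := ρ) a (fun x _ => ha x)
    · intro x hx
      obtain ⟨l, hl⟩ := hsurj x hx
      by_cases hli : l = i
      · exact ⟨j, by simp [hij.symm], by rw [← haij, ← hli, hl]⟩
      · exact ⟨l, by simp [hli], hl⟩
    · rw [Finset.card_erase_of_mem (Finset.mem_univ i), Finset.card_univ]; omega
  intro k l hkl hakl
  by_cases hk : k = i
  · by_cases hl : l = i
    · exact absurd (hk.trans hl.symm) hkl
    · refine Or.inl ⟨hk, hinj (by simp [hl]) (by simp [hij.symm]) ?_⟩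
      rw [← hakl, hk, haij]
  · by_cases hl : l = i
    · refine Or.inr ⟨hinj (by simp [hk]) (by simp [hij.symm]) ?_, hl⟩
      rw [hakl, hl, haij]
    · exact absurd (hinj (by simp [hk]) (by simp [hl]) hakl) hkl

variable [DecidableEq X]

/-- The one-point extensions of a dominating set which are dominating. -/
theorem IsDominating.insert_iff {v : I → X → α} (hv : ∀ i, Function.Injective (v i))
    {ρ : Finset X} (h : IsDominating v ρ)
    {a : I → X} (ha : ∀ i, a i ∈ ρ) (hmin : ∀ i, ∀ x ∈ ρ, v i (a i) ≤ v i x) {i j : I}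
    (hij : i ≠ j) (haij : a i = a j) (hsurj : ∀ x ∈ ρ, ∃ l, a l = x)
    (hpair : ∀ k l, k ≠ l → a k = a l → (k = i ∧ l = j) ∨ (k = j ∧ l = i)) (x : X) :
    (x ∉ ρ ∧ IsDominating v (insert x ρ)) ↔
      ∃ k, (k = i ∨ k = j) ∧ (∀ l, l ≠ k → v l (a l) < v l x) ∧
        ∀ y, (∀ l, l ≠ k → v l (a l) < v l y) → v k y ≤ v k x := by
  constructor
  · rintro ⟨hx, hd⟩
    -- In ranking `k` the new element becomes the minimum. Every old element must stay the minimum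
    -- of some other ranking, so `a k` was a minimum twice and `k` belongs to the colliding pair.
    obtain ⟨k, hk⟩ := hd x
    have hkx : v k x ≤ v k (a k) := hk _ (by simp [ha])
    have hcov : ∀ z ∈ ρ, ∃ l, a l = z ∧ v l (a l) < v l x := by
      intro z hz
      obtain ⟨l, hl⟩ := hd z
      have hal : a l = z := hv l (le_antisymm (hmin l z hz) (hl _ (by simp [ha])))
      refine ⟨l, hal, hal ▸ lt_of_le_of_ne (hl x (by simp)) fun hne => hx ?_⟩
      rwa [← hv l hne]
    have hkL : ∀ z ∈ ρ, ∃ l, l ≠ k ∧ a l = z ∧ v l (a l) < v l x := fun z hz => by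
      obtain ⟨l, hl, hlx⟩ := hcov z hz
      exact ⟨l, fun hlk => by subst hlk; exact absurd hlx (not_lt.2 hkx), hl, hlx⟩
    have hkij : k = i ∨ k = j := by
      obtain ⟨l, hlk, hl, -⟩ := hkL (a k) (ha k)
      rcases hpair l k hlk hl with h' | h'
      · exact Or.inr h'.2
      · exact Or.inl h'.2
    have hM : ∀ l, l ≠ k → v l (a l) < v l x := by
      intro l hl
      obtain ⟨l', hl', hal', hlx'⟩ := hkL (a l) (ha l)
      by_cases hll : l' = l
      · exact hll ▸ hlx'
      · exfalso
        rcases hpair l' l hll hal' with h' | h' <;> rcases hkij with h'' | h'' <;> grind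
    refine ⟨k, hkij, hM, fun y hy => ?_⟩
    obtain ⟨l, hl⟩ := hd y
    by_cases hlk : l = k
    · exact hlk ▸ hl x (by simp)
    · exact absurd (hl (a l) (by simp [ha])) (not_le.2 (hy l hlk))
  · rintro ⟨k, hk, hM, hmax⟩
    refine ⟨fun hx => ?_, fun y => ?_⟩
    · have : ∃ l, l ≠ k ∧ a l = x := by
        obtain ⟨l, hl⟩ := hsurj x hx
        by_cases hlk : l = k
        · rcases hk with rfl | rfl
          · exact ⟨j, hij.symm, by rw [← haij, ← hlk, hl]⟩
          · exact ⟨i, hij, by rw [haij, ← hlk, hl]⟩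
        · exact ⟨l, hlk, hl⟩
      obtain ⟨l, hlk, rfl⟩ := this
      exact lt_irrefl _ (hM l hlk)
    · by_cases hy : ∀ l, l ≠ k → v l (a l) < v l y
      · refine ⟨k, fun z hz => ?_⟩
        rcases Finset.mem_insert.1 hz with rfl | hz
        · exact hmax y hy
        · obtain ⟨l, hl⟩ := h y
          by_cases hlk : l = k
          · exact hlk ▸ hl z (hz)
          · exact absurd (hl _ (ha l)) (not_le.2 (hy l hlk))
      · push Not at hy
        obtain ⟨l, hlk, hl⟩ := hy
        refine ⟨l, fun z hz => ?_⟩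
        rcases Finset.mem_insert.1 hz with rfl | hz
        · exact hl.trans (hM l hlk).le
        · exact hl.trans (hmin l z hz)

variable [Fintype X]

/-- A dominating set with one element less than there are rankings has two dominating one-point
extensions, unless it consists of slack elements, in which case it has one. -/
theorem IsDominating.card_extensions {v : I → X → α} (hv : ∀ i, Function.Injective (v i))
    {s : I → X} (hs : ∀ i x, v i (s i) ≤ v i x)
    (hs' : ∀ i j x, x ∉ Set.range s → i ≠ j → v i x < v i (s j))
    (hX : ∃ t, t ∉ Set.range s)
    {ρ : Finset X} (h : IsDominating v ρ) (hcard : ρ.card + 1 = Fintype.card I)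
    (hne : ρ.Nonempty) [DecidablePred fun x => x ∉ ρ ∧ IsDominating v (insert x ρ)] :
    (Finset.univ.filter fun x => x ∉ ρ ∧ IsDominating v (insert x ρ)).card =
      if ∀ x ∈ ρ, x ∈ Set.range s then 1 else 2 := by
  classical
  choose a ha hmin using fun i => ρ.exists_min_image (v i) hne
  obtain ⟨i, j, hij, haij, hsurj, hpair⟩ := h.exists_collision hv hcard ha hmin
  simp only [h.insert_iff hv ha hmin hij haij hsurj hpair]
  set Q : I → X → Prop := fun k y => ∀ l, l ≠ k → v l (a l) < v l y with hQ
  -- Each of `i`, `j` contributes at most one extension, the maximum of its candidate set. The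
  -- candidate sets are disjoint, since a common element would beat every minimum of `ρ`. It remains
  -- to see which are nonempty.
  have hQij : ∀ y, Q i y → Q j y → False := fun y hi hj => by
    obtain ⟨l, hl⟩ := h y
    refine absurd (hl _ (ha l)) (not_le.2 ?_)
    by_cases hli : l = i
    · exact hj l (hli ▸ hij)
    · exact hi l hli
  have hmax : ∀ k, (∃ y, Q k y) → ∃ x, Q k x ∧ ∀ y, Q k y → v k y ≤ v k x := by
    rintro k ⟨y, hy⟩
    obtain ⟨x, hx, hx'⟩ := (Finset.univ.filter (Q k)).exists_max_image (v k) ⟨y, by simpa using hy⟩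
    exact ⟨x, by simpa using hx, fun y hy => hx' y (by simpa using hy)⟩
  have huniq : ∀ k x y, (Q k x ∧ ∀ z, Q k z → v k z ≤ v k x) →
      (Q k y ∧ ∀ z, Q k z → v k z ≤ v k y) → x = y := fun k x y hx hy =>
    hv k (le_antisymm (hy.2 x hx.1) (hx.2 y hy.1))
  have hsinj : ∀ k l, s k = s l → k = l := fun k l hkl => by
    by_contra hne
    obtain ⟨t, ht⟩ := hX
    have h1 := hs' k l t ht hne
    have h2 := hs k t
    rw [hkl] at h2
    exact absurd h1 (not_lt.2 h2)
  split_ifs with hρ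
  · -- the slack elements in `ρ` are all but one
    have hamem : ∀ l, s l ∈ ρ → a l = s l := fun l hl =>
      hv l (le_antisymm (hmin l _ hl) (hs l _))
    have hm : ∃ m, s m ∉ ρ := by
      by_contra hcon
      push Not at hcon
      have := Finset.card_le_card_of_injOn s (s := Finset.univ) (t := ρ) (fun x _ => hcon x)
        (fun x _ y _ hxy => hsinj x y hxy)
      rw [Finset.card_univ] at this
      omega
    obtain ⟨m, hm⟩ := hm
    obtain ⟨p, hp⟩ := hρ (a m) (ha m)
    have hpm : p ≠ m := by rintro rfl; exact hm (hp ▸ ha p)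
    have hap : a p = s p := hamem p (hp ▸ ha m)
    have hother : ∀ l, l ≠ m → s l ∈ ρ := by
      have hsub : ρ ⊆ (Finset.univ.erase m).image s := fun x hx => by
        obtain ⟨l, rfl⟩ := hρ x hx
        exact Finset.mem_image.2 ⟨l, by
          simp only [Finset.mem_erase, Finset.mem_univ, and_true]; rintro rfl; exact hm hx, rfl⟩
      have heq := Finset.eq_of_subset_of_card_le hsub (by
        refine Finset.card_image_le.trans ?_
        rw [Finset.card_erase_of_mem (Finset.mem_univ m), Finset.card_univ]; omega)
      intro l hl
      rw [heq]
      exact Finset.mem_image.2 ⟨l, by simp [hl], rfl⟩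
    have hQm : ∃ y, Q m y := by
      obtain ⟨t, ht⟩ := hX
      refine ⟨t, fun l hl => ?_⟩
      rw [hamem l (hother l hl)]
      exact lt_of_le_of_ne (hs l t) fun hst => ht ⟨l, hv l hst⟩
    -- The colliding pair is `m`, `p`. A candidate for `p` would lie above `s p` in ranking `m`,
    -- which rules out non-slack elements and `s m`; any other slack element fails in its own
    -- ranking.
    have hQp : ∀ y, ¬ Q p y := by
      intro y hy
      have h1 := hy m hpm.symm
      rw [← hp] at h1
      by_cases hyr : y ∈ Set.range s
      · obtain ⟨q, rfl⟩ := hyr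
        by_cases hqm : q = m
        · subst hqm
          exact absurd h1 (not_lt.2 (hs _ _))
        · by_cases hqp : q = p
          · subst hqp; exact lt_irrefl _ h1
          · have := hy q hqp
            exact absurd this (not_lt.2 (hs _ _))
      · exact absurd h1 (not_lt.2 (hs' m p y hyr hpm.symm).le)
    obtain ⟨x, hx⟩ := hmax m hQm
    rw [Finset.card_eq_one]
    refine ⟨x, ?_⟩
    have hmp := hpair m p hpm.symm (by rw [hap, hp])
    ext y
    simp only [Finset.mem_filter, Finset.mem_univ, true_and, Finset.mem_singleton]
    constructor
    · rintro ⟨k, hk, hy⟩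
      have hkm : k = m ∨ k = p := by grind
      rcases hkm with rfl | rfl
      · exact huniq _ _ _ hy hx
      · exact absurd hy.1 (hQp y)
    · rintro rfl
      exact ⟨m, by grind, hx⟩
  · push Not at hρ
    obtain ⟨t, htρ, ht⟩ := hρ
    have hQk : ∀ k l, k ≠ l → a k = a l → ∃ y, Q k y := by
      intro k l hkl hakl
      -- The non-slack `t` bounds each minimum from above, and `s k` exceeds `t` in every ranking
      -- other than `k`.
      refine ⟨s k, fun q hq => lt_of_le_of_lt (hmin q t htρ) (hs' q k t ht hq)⟩
    obtain ⟨x, hx⟩ := hmax i (hQk i j hij haij)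
    obtain ⟨y, hy⟩ := hmax j (hQk j i hij.symm haij.symm)
    rw [Finset.card_eq_two]
    refine ⟨x, y, fun hxy => hQij x hx.1 (hxy ▸ hy.1), ?_⟩
    ext z
    simp only [Finset.mem_filter, Finset.mem_univ, true_and, Finset.mem_singleton,
      Finset.mem_insert]
    constructor
    · rintro ⟨k, rfl | rfl, hz⟩
      · exact Or.inl (huniq _ _ _ hz hx)
      · exact Or.inr (huniq _ _ _ hz hy)
    · rintro (rfl | rfl)
      · exact ⟨i, Or.inl rfl, hx⟩
      · exact ⟨j, Or.inr rfl, hy⟩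

end Scarf

/-! ### Parity count of rooms and doors -/

section Scarf

theorem exists_insert_eq_of_subset_of_card {X : Type*} [DecidableEq X] {ρ R : Finset X} (h : ρ ⊆ R)
    (hc : ρ.card + 1 = R.card) : ∃ x, x ∉ ρ ∧ insert x ρ = R := by
  obtain ⟨x, hx⟩ := Finset.card_eq_one.1 (show (R \ ρ).card = 1 by
    rw [Finset.card_sdiff_of_subset h]; omega)
  have hxm : x ∈ R \ ρ := by simp [hx]
  refine ⟨x, (Finset.mem_sdiff.1 hxm).2, ?_⟩
  rw [Finset.insert_eq, ← hx, Finset.sdiff_union_of_subset h]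

variable {I X α : Type*} [LinearOrder α] [Fintype I] [DecidableEq I] [DecidableEq X]

/-- A set with as many elements as there are colours which does not carry all of them has an even
number of facets carrying exactly the colours different from `i₀`. -/
theorem even_card_facets (c : X → I) (i₀ : I) {R : Finset X} (hR : R.card = Fintype.card I)
    (hfull : R.image c ≠ Finset.univ) {D : Finset (Finset X)}
    (hD : ∀ ρ, ρ ∈ D ↔ ρ ⊆ R ∧ ρ.card + 1 = Fintype.card I ∧
      ρ.image c = Finset.univ.erase i₀) : Even D.card := by
  rcases D.eq_empty_or_nonempty with rfl | ⟨ρ, hρ⟩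
  · simp
  obtain ⟨hρR, hρc, hρi⟩ := (hD ρ).1 hρ
  obtain ⟨x, hxρ, rfl⟩ := exists_insert_eq_of_subset_of_card hρR (by omega)
  have hinj : ∀ σ : Finset X, σ.card + 1 = Fintype.card I → σ.image c = Finset.univ.erase i₀ →
      Set.InjOn c σ := fun σ h1 h2 => by
    rw [← Finset.card_image_iff, h2, Finset.card_erase_of_mem (Finset.mem_univ _),
      Finset.card_univ]
    omega
  have hcx : c x ≠ i₀ := fun h => hfull (by
    rw [Finset.image_insert, hρi, h, Finset.insert_erase (Finset.mem_univ _)])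
  obtain ⟨x', hx', hcx'⟩ := Finset.mem_image.1
    (show c x ∈ ρ.image c by rw [hρi]; simp [hcx])
  have hxx' : x ≠ x' := fun h => hxρ (h ▸ hx')
  -- Exactly one colour is repeated in `R`, by `x` and `x'`, and a facet in `D` must omit one of
  -- these two.
  suffices h : D = {ρ, (insert x ρ).erase x'} by
    rw [h, Finset.card_pair]
    · exact even_two
    · intro h
      rw [h] at hx'
      simp at hx'
  ext σ
  rw [hD, Finset.mem_insert, Finset.mem_singleton]
  constructor
  · rintro ⟨h1, h2, h3⟩
    obtain ⟨y, hy, hyR⟩ := exists_insert_eq_of_subset_of_card h1 (by omega)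
    have hσ : σ = (insert x ρ).erase y := by rw [← hyR, Finset.erase_insert hy]
    by_cases hyx : y = x
    · left; rw [hσ, hyx, Finset.erase_insert hxρ]
    · by_cases hyx' : y = x'
      · right; rw [hσ, hyx']
      · refine absurd (hinj σ h2 h3 (x₁ := x) (x₂ := x') ?_ ?_ hcx'.symm) hxx'
        · rw [hσ]; simp [Ne.symm hyx]
        · rw [hσ]; simp [Ne.symm hyx', hx']
  · rintro (rfl | rfl)
    · exact ⟨hρR, hρc, hρi⟩
    · refine ⟨Finset.erase_subset _ _, ?_, ?_⟩
      · rw [Finset.card_erase_of_mem (by simp [hx']), Finset.card_insert_of_notMem hxρ]; omega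
      · rw [← hρi, Finset.erase_insert_of_ne hxx', Finset.image_insert, ← hcx',
          ← Finset.image_insert, Finset.insert_erase hx']

variable [Fintype X]

/-- **Scarf's lemma**: for any colouring which gives the slack element of each ranking its own
colour, some dominating set carries every colour exactly once. -/
theorem exists_isDominating_image_eq_univ (hI : 2 ≤ Fintype.card I) {v : I → X → α}
    (hv : ∀ i, Function.Injective (v i))
    {s : I → X} (hs : ∀ i x, v i (s i) ≤ v i x)
    (hs' : ∀ i j x, x ∉ Set.range s → i ≠ j → v i x < v i (s j))
    (hX : ∃ t, t ∉ Set.range s) (c : X → I) (hc : ∀ i, c (s i) = i) :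
    ∃ R : Finset X, R.card = Fintype.card I ∧ IsDominating v R ∧ R.image c = Finset.univ := by
  classical
  by_contra hcon
  push Not at hcon
  obtain ⟨i₀⟩ : Nonempty I := Fintype.card_pos_iff.1 (by omega)
  have hsinj : Function.Injective s := fun i j h => by rw [← hc i, h, hc]
  set rooms : Finset (Finset X) :=
    Finset.univ.filter fun R => R.card = Fintype.card I ∧ IsDominating v R with hrooms
  set doors : Finset (Finset X) := Finset.univ.filter fun ρ =>
    ρ.card + 1 = Fintype.card I ∧ IsDominating v ρ ∧ ρ.image c = Finset.univ.erase i₀ with hdoors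
  -- Incidences of doors and rooms are counted twice. Without a fully coloured room each room has
  -- evenly many doors, whereas each door lies in two rooms except the one made of slack elements,
  -- which lies in one.
  have key := Finset.sum_card_bipartiteAbove_eq_sum_card_bipartiteBelow
    (s := doors) (t := rooms) (fun ρ R => ρ ⊆ R)
  have hR : Even (∑ R ∈ rooms, (doors.bipartiteBelow (fun ρ R => ρ ⊆ R) R).card) := by
    refine Finset.even_sum _ fun R hR => ?_
    obtain ⟨hR1, hR2⟩ := (Finset.mem_filter.1 hR).2
    refine even_card_facets c i₀ hR1 (hcon R hR1 hR2) fun ρ => ?_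
    simp only [Finset.bipartiteBelow, hdoors, Finset.mem_filter, Finset.mem_univ, true_and]
    exact ⟨fun h => ⟨h.2, h.1.1, h.1.2.2⟩, fun h => ⟨⟨h.2.1, hR2.mono h.1, h.2.2⟩, h.1⟩⟩
  have hdoor : ∀ ρ ∈ doors, (rooms.bipartiteAbove (fun ρ R => ρ ⊆ R) ρ).card =
      if ∀ x ∈ ρ, x ∈ Set.range s then 1 else 2 := by
    intro ρ hρ
    obtain ⟨h1, h2, h3⟩ := (Finset.mem_filter.1 hρ).2
    rw [← h2.card_extensions hv hs hs' hX h1 (Finset.card_pos.1 (by omega))]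
    symm
    refine Finset.card_bij (fun x _ => insert x ρ) ?_ ?_ ?_
    · intro x hx
      obtain ⟨hx1, hx2⟩ := (Finset.mem_filter.1 hx).2
      simp only [Finset.bipartiteAbove, hrooms, Finset.mem_filter, Finset.mem_univ, true_and]
      exact ⟨⟨by rw [Finset.card_insert_of_notMem hx1, h1], hx2⟩, Finset.subset_insert _ _⟩
    · intro x hx y hy hxy
      have hx1 := (Finset.mem_filter.1 hx).2.1
      have : x ∈ insert y ρ := by rw [← hxy]; simp
      exact (Finset.mem_insert.1 this).resolve_right hx1
    · intro R hR
      simp only [Finset.bipartiteAbove, hrooms, Finset.mem_filter, Finset.mem_univ, true_and] at hR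
      obtain ⟨x, hx, hxR⟩ := exists_insert_eq_of_subset_of_card hR.2 (by rw [h1, hR.1.1])
      exact ⟨x, by simpa [hx, hxR] using hR.1.2, hxR⟩
  rw [Finset.sum_congr rfl hdoor] at key
  have h0 : (Finset.univ.erase i₀).image s ∈ doors := by
    simp only [hdoors, Finset.mem_filter, Finset.mem_univ, true_and]
    refine ⟨?_, ?_, ?_⟩
    · rw [Finset.card_image_of_injective _ hsinj, Finset.card_erase_of_mem (Finset.mem_univ _),
        Finset.card_univ]
      omega
    · intro y
      by_cases hy : y ∈ Set.range s
      · obtain ⟨j, rfl⟩ := hy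
        exact ⟨j, fun x _ => hs j x⟩
      · refine ⟨i₀, fun x hx => ?_⟩
        obtain ⟨j, hj, rfl⟩ := Finset.mem_image.1 hx
        exact (hs' i₀ j y hy (Finset.ne_of_mem_erase hj).symm).le
    · rw [Finset.image_image, show c ∘ s = id from funext hc, Finset.image_id]
  rw [← Finset.add_sum_erase _ _ h0, if_pos (by simp)] at key
  have hrest : Even (∑ ρ ∈ doors.erase ((Finset.univ.erase i₀).image s),
      if ∀ x ∈ ρ, x ∈ Set.range s then 1 else 2) := by
    refine Finset.even_sum _ fun ρ hρ => ?_
    obtain ⟨hne, hρ⟩ := Finset.mem_erase.1 hρ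
    obtain ⟨h1, h2, h3⟩ := (Finset.mem_filter.1 hρ).2
    rw [if_neg]
    · exact even_two
    · intro hall
      refine hne ?_
      rw [← h3, Finset.image_image]
      symm
      refine (Finset.image_congr fun x hx => ?_).trans Finset.image_id
      obtain ⟨j, rfl⟩ := hall x hx
      simp [hc]
  rw [← key] at hR
  exact (Nat.not_even_iff_odd.2 (odd_one.add_even hrest)) hR

end Scarf

/-! ### Brouwer's fixed point theorem -/

section Brouwer

variable {I : Type*} [Fintype I]

theorem Continuous.stdSimplex_apply {Y : Type*} [TopologicalSpace Y] {f : Y → stdSimplex ℝ I}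
    (hf : Continuous f) (i : I) : Continuous fun y => (f y).1 i :=
  (continuous_apply i).comp (continuous_subtype_val.comp hf)

/-- A Sperner-type lemma for the integer points of the dilated simplex: every colouring has a
point such that each colour occurs nearby or belongs to a small coordinate. -/
theorem exists_grid_point (hI : 2 ≤ Fintype.card I) (m : ℕ) (c : (I → ℕ) → I) :
    ∃ x : I → ℕ, ∑ i, x i = m ∧ ∀ i, x i ≤ Fintype.card I ∨
      ∃ y : I → ℕ, ∑ i, y i = m ∧ c y = i ∧
        ∀ j, x j ≤ y j + Fintype.card I ∧ y j ≤ x j + Fintype.card I := by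
  classical
  set T := {x : I → ℕ // x ∈ Finset.piAntidiag (Finset.univ : Finset I) m} with hT
  have hTsum : ∀ t : T, ∑ i, t.1 i = m := fun t => (Finset.mem_piAntidiag.1 t.2).1
  have hTmk : ∀ y : I → ℕ, ∑ i, y i = m → ∃ t : T, t.1 = y := fun y hy =>
    ⟨⟨y, Finset.mem_piAntidiag.2 ⟨hy, fun i _ => Finset.mem_univ i⟩⟩, rfl⟩
  have hTle : ∀ (t : T) i, t.1 i ≤ m := fun t i =>
    (Finset.single_le_sum (f := t.1) (fun _ _ => Nat.zero_le _) (Finset.mem_univ i)).trans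
      (hTsum t).le
  obtain ⟨i₀⟩ : Nonempty I := Fintype.card_pos_iff.1 (by omega)
  let e : T ⊕ I → ℕ := fun x => (Fintype.equivFin (T ⊕ I) x).val
  have he : Function.Injective e := Fin.val_injective.comp (Fintype.equivFin (T ⊕ I)).injective
  -- Grid coordinates lie in `[0, m]`, so `-1` puts a slack element last in its own ranking and `m +
  -- 1` puts it above all grid points elsewhere. The enumeration `e` breaks ties.
  let p : T ⊕ I → I → ℤ := Sum.elim (fun t i => t.1 i) fun j i => if i = j then -1 else m + 1
  let v : I → T ⊕ I → ℤ ×ₗ ℕ := fun i x => toLex (p x i, e x)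
  have hv : ∀ i, Function.Injective (v i) := fun i x y h => by
    have := congrArg (fun z => (ofLex z).2) h
    exact he this
  have hlt : ∀ i x y, p x i < p y i → v i x < v i y := fun i x y h =>
    Prod.Lex.toLex_lt_toLex.2 (Or.inl h)
  have hle : ∀ i x y, v i x ≤ v i y → p x i ≤ p y i := fun i x y h =>
    le_of_not_gt fun h' => absurd (hlt i y x h') (not_lt.2 h)
  obtain ⟨R, hRcard, hRd, hRc⟩ := exists_isDominating_image_eq_univ hI hv (s := Sum.inr)
    (fun i x => by
      rcases x with t | j
      · exact (hlt _ _ _ (by simp only [p, Sum.elim_inl, Sum.elim_inr, if_true]; omega)).le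
      · by_cases hij : i = j
        · rw [hij]
        · exact (hlt _ _ _ (by
            simp only [p, Sum.elim_inr, if_true, if_neg hij]; omega)).le)
    (fun i j x hx hij => by
      rcases x with t | k
      · refine hlt _ _ _ ?_
        have := hTle t i
        simp only [p, Sum.elim_inl, Sum.elim_inr, if_neg hij]
        omega
      · exact absurd ⟨k, rfl⟩ hx)
    (by
      obtain ⟨t, -⟩ := hTmk (Pi.single i₀ m) (by simp)
      exact ⟨Sum.inl t, by simp⟩)
    (Sum.elim (fun t => c t.1) id) (fun i => rfl)
  set C : Finset I := Finset.univ.filter fun i => Sum.inr i ∉ R with hC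
  have hdom : ∀ y : I → ℕ, ∑ i, y i = m → ∃ i ∈ C, ∀ t : T, Sum.inl t ∈ R → y i ≤ t.1 i := by
    intro y hy
    obtain ⟨t, rfl⟩ := hTmk y hy
    obtain ⟨i, hi⟩ := hRd (Sum.inl t)
    refine ⟨i, ?_, fun t' ht' => ?_⟩
    · simp only [hC, Finset.mem_filter, Finset.mem_univ, true_and]
      intro hiR
      have := hle _ _ _ (hi _ hiR)
      simp only [p, Sum.elim_inl, Sum.elim_inr, if_true] at this
      omega
    · have := hle _ _ _ (hi _ ht')
      simp only [p, Sum.elim_inl] at this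
      exact_mod_cast this
  have hcol : ∀ i ∈ C, ∃ t : T, Sum.inl t ∈ R ∧ c t.1 = i := by
    intro i hi
    obtain ⟨x, hx, hxi⟩ := Finset.mem_image.1 (show i ∈ R.image _ from hRc ▸ Finset.mem_univ i)
    rcases x with t | j
    · exact ⟨t, hx, hxi⟩
    · exact absurd (show Sum.inr i ∈ R from (show j = i from hxi) ▸ hx) (Finset.mem_filter.1 hi).2
  obtain ⟨k, hkC, -⟩ := hdom (Pi.single i₀ m) (by simp)
  obtain ⟨t₀, ht₀, -⟩ := hcol k hkC
  choose q hq hqmin using fun i => (Finset.univ.filter fun t : T => Sum.inl t ∈ R).exists_min_image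
    (fun t => t.1 i) ⟨t₀, by simpa using ht₀⟩
  simp only [Finset.mem_filter, Finset.mem_univ, true_and] at hq hqmin
  set μ : I → ℕ := fun i => if i ∈ C then (q i).1 i else 0 with hμ
  have hμle : ∀ t : T, Sum.inl t ∈ R → ∀ i, μ i ≤ t.1 i := fun t ht i => by
    simp only [hμ]
    split_ifs
    · exact hqmin i t ht
    · exact Nat.zero_le _
  -- Otherwise some grid point exceeds `μ` in every coordinate, contradicting domination. Hence grid
  -- points of `R` exceed `μ` by less than `Fintype.card I` in total, which keeps them close
  -- together.
  have hμsum : m < ∑ i, μ i + Fintype.card I := by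
    by_contra hcon
    push Not at hcon
    set y : I → ℕ := fun i =>
      (μ i + 1) + (Pi.single k (m - (∑ i, μ i + Fintype.card I)) : I → ℕ) i with hy
    obtain ⟨i, hiC, hi⟩ := hdom y (by
      simp only [hy, Finset.sum_add_distrib, Finset.sum_pi_single', Finset.sum_const,
        Finset.card_univ, smul_eq_mul, mul_one, Finset.mem_univ, if_true]
      omega)
    have := hi (q i) (hq i)
    simp only [hy, hμ, if_pos hiC] at this
    omega
  have hclose : ∀ t : T, Sum.inl t ∈ R → ∀ i, t.1 i ≤ μ i + Fintype.card I := by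
    intro t ht i
    have h1 : ∑ j ∈ Finset.univ.erase i, μ j ≤ ∑ j ∈ Finset.univ.erase i, t.1 j :=
      Finset.sum_le_sum fun j _ => hμle t ht j
    have h2 := Finset.add_sum_erase Finset.univ μ (Finset.mem_univ i)
    have h3 := Finset.add_sum_erase Finset.univ t.1 (Finset.mem_univ i)
    have h4 := hTsum t
    omega
  refine ⟨t₀.1, hTsum t₀, fun i => ?_⟩
  by_cases hi : i ∈ C
  · obtain ⟨t, ht, hti⟩ := hcol i hi
    refine Or.inr ⟨t.1, hTsum t, hti, fun j => ⟨?_, ?_⟩⟩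
    · exact (hclose t₀ ht₀ j).trans (Nat.add_le_add_right (hμle t ht j) _)
    · exact (hclose t ht j).trans (Nat.add_le_add_right (hμle t₀ ht₀ j) _)
  · left
    have := hclose t₀ ht₀ i
    simpa [hμ, hi] using this

/-- Colour a grid point by a coordinate that `f` does not decrease. Near the point from
`exists_grid_point` each coordinate is either tiny or not decreased at some neighbour, and uniform
continuity transfers this. A one-sided bound suffices because both coordinate sums are 1. -/
theorem exists_approx_fixedPoint_stdSimplex (hI : 2 ≤ Fintype.card I)
    {f : stdSimplex ℝ I → stdSimplex ℝ I} (hf : Continuous f) {ε : ℝ} (hε : 0 < ε) :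
    ∃ x : stdSimplex ℝ I, ∀ i, x.1 i - (f x).1 i ≤ ε := by
  classical
  obtain ⟨δ, hδ, hfδ⟩ := Metric.uniformContinuous_iff.1
    (CompactSpace.uniformContinuous_of_continuous hf) (ε / 2) (by positivity)
  obtain ⟨m, hm⟩ := exists_nat_gt ((Fintype.card I : ℝ) / min δ (ε / 2))
  have hmin : 0 < min δ (ε / 2) := lt_min hδ (by positivity)
  have hm0 : (0 : ℝ) < m := lt_of_le_of_lt (by positivity) hm
  have hnm : (Fintype.card I : ℝ) / m < min δ (ε / 2) := by
    rw [div_lt_iff₀ hmin] at hm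
    rw [div_lt_iff₀ hm0]
    linarith
  have hnδ := hnm.trans_le (min_le_left _ _)
  have hnε := hnm.trans_le (min_le_right _ _)
  let pt : (y : I → ℕ) → ∑ i, y i = m → stdSimplex ℝ I := fun y hy =>
    ⟨fun i => y i / m, fun i => by positivity, by
      rw [← Finset.sum_div, ← Nat.cast_sum, hy, div_self hm0.ne']⟩
  have : Nonempty I := Fintype.card_pos_iff.1 (by omega)
  have hcol : ∀ y : I → ℕ, ∃ i, ∀ hy : ∑ i, y i = m, (pt y hy).1 i ≤ (f (pt y hy)).1 i := by
    intro y
    by_cases hy : ∑ i, y i = m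
    · obtain ⟨i, -, hi⟩ := Finset.exists_le_of_sum_le (s := Finset.univ)
        (f := (pt y hy).1) (g := (f (pt y hy)).1) Finset.univ_nonempty
        ((pt y hy).2.2.trans (f (pt y hy)).2.2.symm).le
      exact ⟨i, fun _ => hi⟩
    · exact ⟨Classical.arbitrary I, fun h => absurd h hy⟩
  choose c hc using hcol
  obtain ⟨x, hx, hxc⟩ := exists_grid_point hI m c
  refine ⟨pt x hx, fun i => ?_⟩
  rcases hxc i with h | ⟨y, hy, rfl, hxy⟩
  · have h1 : (pt x hx).1 i ≤ Fintype.card I / m := by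
      simp only [pt]
      gcongr
    have h2 := (f (pt x hx)).2.1 i
    linarith
  · have habs : ∀ j, |(pt y hy).1 j - (pt x hx).1 j| ≤ Fintype.card I / m := fun j => by
      have h1 : (x j : ℝ) ≤ y j + Fintype.card I := by exact_mod_cast (hxy j).1
      have h2 : (y j : ℝ) ≤ x j + Fintype.card I := by exact_mod_cast (hxy j).2
      simp only [pt]
      rw [← sub_div, abs_div, abs_of_pos hm0]
      gcongr
      rw [abs_le]
      constructor <;> linarith
    have hd : dist (pt y hy) (pt x hx) < δ := by
      refine lt_of_le_of_lt ?_ hnδ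
      rw [Subtype.dist_eq, dist_pi_le_iff (by positivity)]
      exact habs
    have h1 := hfδ hd
    rw [Subtype.dist_eq] at h1
    have h2 := (dist_le_pi_dist _ _ (c y)).trans_lt h1
    rw [Real.dist_eq] at h2
    have h3 := (abs_le.1 (habs (c y))).1
    have h4 := hc y hy
    have h5 := (abs_lt.1 h2).2
    linarith

/-- **Brouwer's fixed point theorem** for the standard simplex. -/
theorem exists_fixedPoint_stdSimplex [Nonempty I]
    {f : stdSimplex ℝ I → stdSimplex ℝ I} (hf : Continuous f) : ∃ x, f x = x := by
  classical
  have hne : Nonempty (stdSimplex ℝ I) :=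
    ⟨⟨_, single_mem_stdSimplex ℝ (Classical.arbitrary I)⟩⟩
  suffices h : ∃ x : stdSimplex ℝ I, ∀ i, x.1 i ≤ (f x).1 i by
    obtain ⟨x, hx⟩ := h
    refine ⟨x, Subtype.ext (funext fun i => ?_)⟩
    have := (Finset.sum_eq_sum_iff_of_le (fun i _ => hx i)).1
      (x.2.2.trans (f x).2.2.symm) i (Finset.mem_univ i)
    exact this.symm
  by_cases hI : 2 ≤ Fintype.card I
  · set g : stdSimplex ℝ I → ℝ := fun x => ∑ i, max 0 (x.1 i - (f x).1 i) with hg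
    have hgc : Continuous g := continuous_finsetSum _ fun i _ =>
      continuous_const.max ((continuous_id.stdSimplex_apply i).sub (hf.stdSimplex_apply i))
    obtain ⟨x, -, hx⟩ := isCompact_univ.exists_isMinOn (Set.univ_nonempty) hgc.continuousOn
    refine ⟨x, fun i => ?_⟩
    -- The minimum of `g` is attained at `x`, and approximate fixed points make `g` arbitrarily
    -- small.
    have hx0 : g x ≤ 0 := by
      refine le_of_forall_pos_le_add fun ε hε => ?_
      have hn : (0 : ℝ) < Fintype.card I := by exact_mod_cast (by omega : 0 < Fintype.card I)
      obtain ⟨y, hy⟩ := exists_approx_fixedPoint_stdSimplex hI hf (div_pos hε hn)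
      refine (hx (Set.mem_univ y)).trans ?_
      calc g y ≤ ∑ _i : I, ε / Fintype.card I :=
            Finset.sum_le_sum fun i _ => max_le (by positivity) (hy i)
        _ = 0 + ε := by
            rw [Finset.sum_const, Finset.card_univ, nsmul_eq_mul]
            field_simp
            ring
    have h1 : max 0 (x.1 i - (f x).1 i) ≤ g x :=
      Finset.single_le_sum (f := fun i => max 0 (x.1 i - (f x).1 i))
        (fun _ _ => le_max_left _ _) (Finset.mem_univ i)
    have h2 := (le_max_right 0 (x.1 i - (f x).1 i)).trans (h1.trans hx0)
    linarith
  · have hsub : Subsingleton I := Fintype.card_le_one_iff_subsingleton.1 (by omega)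
    obtain ⟨x⟩ := hne
    refine ⟨x, fun i => ?_⟩
    have : Unique I := uniqueOfSubsingleton i
    have h1 := x.2.2
    have h2 := (f x).2.2
    rw [Fintype.sum_subsingleton _ i] at h1 h2
    rw [h1, h2]

/-- A retract of the standard simplex has the fixed point property. -/
theorem exists_fixedPoint_of_retract [Nonempty I] {K : Type*} [TopologicalSpace K]
    {g : K → stdSimplex ℝ I} {r : stdSimplex ℝ I → K} (hg : Continuous g) (hr : Continuous r)
    (hrg : Function.LeftInverse r g) {f : K → K} (hf : Continuous f) : ∃ x, f x = x := by
  obtain ⟨x, hx⟩ := exists_fixedPoint_stdSimplex (hg.comp (hf.comp hr))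
  refine ⟨r x, ?_⟩
  calc f (r x) = r (g (f (r x))) := (hrg _).symm
    _ = r x := congrArg r hx

end Brouwer

/-! ### Nash's theorem -/

section Nash

variable {ι : Type*} [Fintype ι] {A : ι → Type*} [∀ i, Fintype (A i)]

/-- The map from the simplex on all pairs of a player and an action to mixed strategy profiles
which renormalizes the weights of each player. -/
noncomputable def simplexToProfile [∀ i, Nonempty (A i)] (x : stdSimplex ℝ (Σ i, A i)) (i : ι) :
    stdSimplex ℝ (A i) :=
  -- A player's missing mass is spread uniformly and excess mass is divided out. This avoids
  -- division by zero and changes nothing when the scaled weights already sum to 1.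
  ⟨fun a => (Fintype.card ι * x.1 ⟨i, a⟩ +
      max 0 (1 - ∑ b, Fintype.card ι * x.1 ⟨i, b⟩) / Fintype.card (A i)) /
      max 1 (∑ b, Fintype.card ι * x.1 ⟨i, b⟩), by
    intro a
    have := x.2.1 ⟨i, a⟩
    positivity, by
    rw [← Finset.sum_div, Finset.sum_add_distrib, Finset.sum_const, Finset.card_univ,
      nsmul_eq_mul, mul_div_cancel₀ _ (by simp)]
    rw [div_eq_one_iff_eq (by positivity)]
    rcases le_total (∑ b, Fintype.card ι * x.1 ⟨i, b⟩) 1 with h | h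
    · rw [max_eq_right (by linarith), max_eq_left h]; ring
    · rw [max_eq_left (by linarith), max_eq_right h]; ring⟩

/-- The mixed strategy profiles as points of the simplex on all pairs of a player and an
action. -/
noncomputable def profileToSimplex [Nonempty ι] (σ : ∀ i, stdSimplex ℝ (A i)) :
    stdSimplex ℝ (Σ i, A i) :=
  ⟨fun p => (σ p.1).1 p.2 / Fintype.card ι, fun p => div_nonneg ((σ p.1).2.1 _) (by positivity), by
    rw [Fintype.sum_sigma]
    simp only [← Finset.sum_div, (σ _).2.2]
    rw [Finset.sum_const, Finset.card_univ, nsmul_eq_mul, mul_one, div_self (by simp)]⟩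

theorem continuous_simplexToProfile [∀ i, Nonempty (A i)] :
    Continuous (simplexToProfile (A := A)) := by
  refine continuous_pi fun i => Continuous.subtype_mk (continuous_pi fun a => ?_) _
  have hmul : ∀ b, Continuous fun x : stdSimplex ℝ (Σ i, A i) => Fintype.card ι * x.1 ⟨i, b⟩ :=
    fun b => continuous_const.mul (continuous_id.stdSimplex_apply _)
  have hsum := continuous_finsetSum Finset.univ fun b _ => hmul b
  refine Continuous.div ((hmul a).add ((continuous_const.max
    (continuous_const.sub hsum)).div_const _)) (continuous_const.max hsum) fun x => ?_
  positivity

theorem continuous_profileToSimplex [Nonempty ι] : Continuous (profileToSimplex (A := A)) := by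
  refine Continuous.subtype_mk (continuous_pi fun p => ?_) _
  exact ((continuous_apply p.1).stdSimplex_apply p.2).div_const _

theorem simplexToProfile_profileToSimplex [Nonempty ι] [∀ i, Nonempty (A i)] :
    Function.LeftInverse (simplexToProfile (A := A)) profileToSimplex := by
  intro σ
  funext i
  have hn : (Fintype.card ι : ℝ) ≠ 0 := by simp
  have h1 : ∀ a, (Fintype.card ι : ℝ) * ((σ i).1 a / Fintype.card ι) = (σ i).1 a := fun a => by
    field_simp
  refine Subtype.ext (funext fun a => ?_)
  simp only [simplexToProfile, profileToSimplex, h1, (σ i).2.2]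
  simp

theorem exists_fixedPoint_pi_stdSimplex [∀ i, Nonempty (A i)]
    {f : (∀ i, stdSimplex ℝ (A i)) → ∀ i, stdSimplex ℝ (A i)} (hf : Continuous f) :
    ∃ σ, f σ = σ := by
  rcases isEmpty_or_nonempty ι with h | h
  · exact ⟨isEmptyElim, Subsingleton.elim _ _⟩
  · have : Nonempty (Σ i, A i) := ⟨⟨Classical.arbitrary ι, Classical.arbitrary _⟩⟩
    exact exists_fixedPoint_of_retract continuous_profileToSimplex continuous_simplexToProfile
      simplexToProfile_profileToSimplex hf

variable [DecidableEq ι]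

/-- The expected payoff of a mixed strategy profile. -/
noncomputable def expectedPayoff (w : (∀ i, A i) → ℝ) (σ : ∀ i, stdSimplex ℝ (A i)) : ℝ :=
  ∑ a, (∏ j, (σ j).1 (a j)) * w a

theorem continuous_expectedPayoff (w : (∀ i, A i) → ℝ) :
    Continuous (expectedPayoff (A := A) w) :=
  continuous_finsetSum _ fun a _ => (continuous_finsetProd _ fun j _ =>
    (continuous_apply j).stdSimplex_apply (a j)).mul continuous_const

/-- Payoff is linear in a player's own strategy, so only pure deviations need testing. -/
theorem expectedPayoff_update (w : (∀ i, A i) → ℝ) (σ : ∀ i, stdSimplex ℝ (A i)) (i : ι)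
    [DecidableEq (A i)] (τ : stdSimplex ℝ (A i)) :
    expectedPayoff w (Function.update σ i τ) = ∑ b, τ.1 b *
      expectedPayoff w (Function.update σ i ⟨Pi.single b 1, single_mem_stdSimplex ℝ b⟩) := by
  have hprod : ∀ (τ : stdSimplex ℝ (A i)) (a : ∀ i, A i),
      ∏ j, (Function.update σ i τ j).1 (a j) =
        τ.1 (a i) * ∏ j ∈ Finset.univ.erase i, (σ j).1 (a j) := fun τ a => by
    rw [← Finset.mul_prod_erase _ _ (Finset.mem_univ i), Function.update_self]
    congr 1
    refine Finset.prod_congr rfl fun j hj => ?_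
    rw [Function.update_of_ne (Finset.ne_of_mem_erase hj)]
  simp only [expectedPayoff, hprod, Finset.mul_sum]
  rw [Finset.sum_comm]
  refine Finset.sum_congr rfl fun a _ => ?_
  rw [Finset.sum_eq_single (a i)]
  · simp; ring
  · intro b _ hb
    simp [Pi.single_eq_of_ne hb.symm]
  · simp

/-- **Nash's theorem**: every finite game has an equilibrium in mixed strategies. -/
theorem exists_nashEquilibrium [∀ i, Nonempty (A i)] (u : ι → (∀ i, A i) → ℝ) :
    ∃ σ : ∀ i, stdSimplex ℝ (A i), ∀ (i : ι) (τ : stdSimplex ℝ (A i)),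
      expectedPayoff (u i) (Function.update σ i τ) ≤ expectedPayoff (u i) σ := by
  classical
  set d : (∀ i, stdSimplex ℝ (A i)) → ∀ i, A i → ℝ := fun σ i b =>
    expectedPayoff (u i) (Function.update σ i ⟨Pi.single b 1, single_mem_stdSimplex ℝ b⟩) -
      expectedPayoff (u i) σ with hd
  have hdc : ∀ i b, Continuous fun σ => d σ i b := fun i b =>
    ((continuous_expectedPayoff _).comp (continuous_id.update i continuous_const)).sub
      (continuous_expectedPayoff _)
  have hden : ∀ σ i, 0 < 1 + ∑ b, max 0 (d σ i b) := fun σ i => by positivity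
  -- Nash's map: shift weight towards actions with positive gain, then renormalize.
  let f : (∀ i, stdSimplex ℝ (A i)) → ∀ i, stdSimplex ℝ (A i) := fun σ i =>
    ⟨fun a => ((σ i).1 a + max 0 (d σ i a)) / (1 + ∑ b, max 0 (d σ i b)),
      fun a => div_nonneg (add_nonneg ((σ i).2.1 a) (le_max_left _ _)) (hden σ i).le, by
      rw [← Finset.sum_div, Finset.sum_add_distrib, (σ i).2.2, div_self (hden σ i).ne']⟩
  have hf : Continuous f := by
    refine continuous_pi fun i => Continuous.subtype_mk (continuous_pi fun a => ?_) _
    exact Continuous.div (((continuous_apply i).stdSimplex_apply a).add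
      (continuous_const.max (hdc i a)))
      (continuous_const.add (continuous_finsetSum _ fun b _ => continuous_const.max (hdc i b))) fun σ => (hden σ i).ne'
  obtain ⟨σ, hσ⟩ := exists_fixedPoint_pi_stdSimplex hf
  refine ⟨σ, fun i τ => ?_⟩
  have hfix : ∀ a, (σ i).1 a * ∑ b, max 0 (d σ i b) = max 0 (d σ i a) := fun a => by
    have h1 : ((σ i).1 a + max 0 (d σ i a)) / (1 + ∑ b, max 0 (d σ i b)) = (σ i).1 a :=
      congrFun (congrArg Subtype.val (congrFun hσ i)) a
    rw [div_eq_iff (hden σ i).ne'] at h1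
    linarith
  have hdev : ∀ τ : stdSimplex ℝ (A i),
      expectedPayoff (u i) (Function.update σ i τ) - expectedPayoff (u i) σ =
        ∑ b, τ.1 b * d σ i b := fun τ => by
    rw [expectedPayoff_update]
    simp only [hd, mul_sub, Finset.sum_sub_distrib, ← Finset.sum_mul, τ.2.2, one_mul]
  have hself := hdev (σ i)
  rw [Function.update_eq_self, sub_self] at hself
  -- If some gain were positive, `hfix` would make every played action gain. The mean gain under `σ
  -- i` is zero, so the profitable action has weight zero, against `hfix`.
  have hd0 : ∀ b, d σ i b ≤ 0 := by
    by_contra! hcon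
    obtain ⟨b, hb⟩ := hcon
    have hS : 0 < ∑ b, max 0 (d σ i b) := Finset.sum_pos'
      (fun _ _ => le_max_left _ _) ⟨b, Finset.mem_univ b, lt_max_of_lt_right hb⟩
    have hterm : ∀ a, 0 ≤ (σ i).1 a * d σ i a := fun a => by
      rcases ((σ i).2.1 a).eq_or_lt with h | h
      · rw [← h, zero_mul]
      · have h1 := hfix a ▸ mul_pos h hS
        exact mul_nonneg h.le ((lt_max_iff.1 h1).resolve_left (lt_irrefl _)).le
    have hb0 := (Finset.sum_eq_zero_iff_of_nonneg fun a _ => hterm a).1 hself.symm b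
      (Finset.mem_univ b)
    have hσb := (mul_eq_zero.1 hb0).resolve_right hb.ne'
    have := hfix b
    rw [hσb, zero_mul, max_eq_right hb.le] at this
    exact hb.ne this
  have := hdev τ
  have h2 : ∑ b, τ.1 b * d σ i b ≤ 0 :=
    Finset.sum_nonpos fun b _ => mul_nonpos_of_nonneg_of_nonpos (τ.2.1 b) (hd0 b)
  linarith

end Nash

/-! ### Backward induction -/

theorem PolicyProfile.joint_apply {N H : ℕ} {S : Type*} {A : Fin N → Type*} [∀ i, Fintype (A i)]
    (π : PolicyProfile H S A) (h : Fin H) (s : S) (a : ∀ i, A i) :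
    (π.joint h s).1 a = ∏ i, (π i h s).1 (a i) :=
  rfl

namespace MOMG

variable {N : ℕ} {S : Type*} [Fintype S] {A : Fin N → Type*} {H M : ℕ}

/-- The game that remains after the first step. -/
def tail (G : MOMG N S A (H + 1) M) : MOMG N S A H M where
  P h := G.P h.succ
  r j h := G.r j h.succ
  r_mem j h := G.r_mem j h.succ

variable [∀ i, Fintype (A i)]

-- The point mass that starts the tail trajectory selects `s' = (τ 0).1` from the sum. With no steps
-- left, the transition probabilities just sum to 1.
open Classical in
theorem trajProb_cons (G : MOMG N S A (H + 1) M) (π : MarkovPolicy (H + 1) S (∀ i, A i))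
    (s₁ s : S) (a : ∀ i, A i) (τ : Fin H → S × (∀ i, A i)) :
    G.trajProb π s₁ (Fin.cons (s, a) τ : Fin (H + 1) → S × (∀ i, A i)) =
      (Pi.single s₁ 1 : S → ℝ) s * ((π 0 s).1 a *
        ∑ s', (G.P 0 s a).1 s' * G.tail.trajProb (fun h => π h.succ) s' τ) := by
  have h0 : ∀ {K : ℕ} (G : MOMG N S A (K + 1) M) (s₁ : S) (τ : Fin (K + 1) → S × (∀ i, A i)),
      G.stateLaw s₁ τ 0 = Pi.single s₁ 1 := fun _ _ _ => rfl
  rw [trajProb, Fin.prod_univ_succ, h0]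
  simp only [Fin.cons_zero, Fin.cons_succ]
  rw [mul_assoc]
  congr 2
  cases H with
  | zero => simp [trajProb, (G.P 0 s a).2.2]
  | succ H =>
    have h1 : G.stateLaw s₁ (Fin.cons (s, a) τ : Fin (H + 2) → S × (∀ i, A i)) (Fin.succ 0) =
        (G.P 0 s a).1 := rfl
    -- Beyond its first step the state law ignores the initial state, so `s'` is arbitrary here.
    have h2 : ∀ (s' : S) (h : Fin H),
        G.stateLaw s₁ (Fin.cons (s, a) τ : Fin (H + 2) → S × (∀ i, A i)) h.succ.succ =
          G.tail.stateLaw s' τ h.succ := fun _ _ => rfl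
    simp only [trajProb]
    rw [Fin.prod_univ_succ, h1]
    simp only [Fin.prod_univ_succ (n := H), h0, h2 s]
    rw [Finset.sum_eq_single (τ 0).1]
    · rw [Pi.single_eq_same, one_mul, mul_assoc]
      rfl
    · intro s' _ hs'
      rw [Pi.single_eq_of_ne hs'.symm]
      simp
    · simp

/-- Expectations over trajectories, conditioned on the first step. -/
theorem sum_trajProb_mul (G : MOMG N S A (H + 1) M) (π : MarkovPolicy (H + 1) S (∀ i, A i))
    (s₁ : S) (f : (Fin (H + 1) → S × (∀ i, A i)) → ℝ) :
    ∑ τ, G.trajProb π s₁ τ * f τ = ∑ a, (π 0 s₁).1 a * ∑ s', (G.P 0 s₁ a).1 s' *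
      ∑ τ, G.tail.trajProb (fun h => π h.succ) s' τ * f (Fin.cons (s₁, a) τ) := by
  classical
  rw [← (Fin.consEquiv fun _ : Fin (H + 1) => S × (∀ i, A i)).sum_comp, Fintype.sum_prod_type,
    Fintype.sum_prod_type]
  simp only [Fin.consEquiv, Equiv.coe_fn_mk, trajProb_cons]
  rw [Finset.sum_eq_single s₁]
  · refine Finset.sum_congr rfl fun a _ => ?_
    simp only [Pi.single_eq_same, one_mul, Finset.mul_sum, Finset.sum_mul]
    rw [Finset.sum_comm]
    refine Finset.sum_congr rfl fun s' _ => Finset.sum_congr rfl fun τ _ => by ring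
  · intro s _ hs
    simp [Pi.single_eq_of_ne hs]
  · simp

theorem sum_trajProb (G : MOMG N S A H M) (π : MarkovPolicy H S (∀ i, A i)) (s₁ : S) :
    ∑ τ, G.trajProb π s₁ τ = 1 := by
  induction H generalizing s₁ with
  | zero => simp [trajProb]
  | succ H ih =>
    have := G.sum_trajProb_mul π s₁ fun _ => 1
    simp only [mul_one, ih] at this
    rw [this]
    simp only [(G.P _ _ _).2.2, mul_one, (π 0 s₁).2.2]

/-- The sum of the values of an agent over all objectives. -/
noncomputable def totalValue (G : MOMG N S A H M) (π : MarkovPolicy H S (∀ i, A i)) (j : Fin N)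
    (s₁ : S) : ℝ :=
  ∑ m, G.value π j s₁ m

theorem totalValue_eq (G : MOMG N S A H M) (π : MarkovPolicy H S (∀ i, A i)) (j : Fin N)
    (s₁ : S) : G.totalValue π j s₁ =
      ∑ τ, G.trajProb π s₁ τ * ∑ h, ∑ m, G.r j h (τ h).1 (τ h).2 m := by
  simp only [totalValue, value]
  rw [Finset.sum_comm]
  refine Finset.sum_congr rfl fun τ _ => ?_
  rw [← Finset.mul_sum, Finset.sum_comm]

/-- The total payoff of an agent in the stage game at the first step, when the policy `π` is
followed afterwards. -/
noncomputable def stagePayoff (G : MOMG N S A (H + 1) M) (π : MarkovPolicy H S (∀ i, A i))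
    (s : S) (j : Fin N) (a : ∀ i, A i) : ℝ :=
  ∑ m, G.r j 0 s a m + ∑ s', (G.P 0 s a).1 s' * G.tail.totalValue π j s'

/-- The **Bellman equation**. -/
theorem totalValue_succ (G : MOMG N S A (H + 1) M) (π : MarkovPolicy (H + 1) S (∀ i, A i))
    (j : Fin N) (s₁ : S) : G.totalValue π j s₁ =
      ∑ a, (π 0 s₁).1 a * G.stagePayoff (fun h => π h.succ) s₁ j a := by
  rw [totalValue_eq, sum_trajProb_mul]
  refine Finset.sum_congr rfl fun a _ => ?_
  congr 1
  simp only [Fin.sum_univ_succ, Fin.cons_zero, Fin.cons_succ, mul_add, Finset.sum_add_distrib,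
    ← Finset.sum_mul, sum_trajProb, one_mul, (G.P _ _ _).2.2, stagePayoff, totalValue_eq]
  rfl

/-- A profile in stochastic Markov policies which from every state is an equilibrium for the
sums of the objectives. -/
theorem exists_totalValue_equilibrium [∀ i, Nonempty (A i)] (G : MOMG N S A H M) :
    ∃ π : PolicyProfile H S A, ∀ (s₁ : S) (k : Fin N) (π' : MarkovPolicy H S (A k)),
      G.totalValue (PolicyProfile.joint (Function.update π k π')) k s₁ ≤
        G.totalValue (PolicyProfile.joint π) k s₁ := by
  induction H with
  | zero =>
    exact ⟨fun _ => Fin.elim0, fun s₁ k π' => by simp [totalValue_eq]⟩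
  | succ H ih =>
    obtain ⟨ρ, hρ⟩ := ih G.tail
    choose σ hσ using fun s => exists_nashEquilibrium (G.stagePayoff (PolicyProfile.joint ρ) s)
    let π : PolicyProfile (H + 1) S A := fun i =>
      Fin.cons (α := fun _ => S → stdSimplex ℝ (A i)) (fun s => σ s i) (ρ i)
    refine ⟨π, fun s₁ k π' => ?_⟩
    have htail : (fun h : Fin H => PolicyProfile.joint (Function.update π k π') h.succ) =
        PolicyProfile.joint (Function.update ρ k fun h => π' h.succ) := by
      funext h s
      refine Subtype.ext (funext fun a => ?_)
      rw [PolicyProfile.joint_apply, PolicyProfile.joint_apply]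
      refine Finset.prod_congr rfl fun i _ => ?_
      by_cases hi : i = k
      · subst hi; simp only [Function.update_self]
      · simp only [Function.update_of_ne hi, π, Fin.cons_succ]
    have hhead : ∀ a, (PolicyProfile.joint (Function.update π k π') 0 s₁).1 a =
        ∏ i, (Function.update (σ s₁) k (π' 0 s₁) i).1 (a i) := by
      intro a
      rw [PolicyProfile.joint_apply]
      refine Finset.prod_congr rfl fun i _ => ?_
      by_cases hi : i = k
      · subst hi; simp only [Function.update_self]
      · simp only [Function.update_of_ne hi, π, Fin.cons_zero]
    calc G.totalValue (PolicyProfile.joint (Function.update π k π')) k s₁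
        ≤ expectedPayoff (G.stagePayoff (PolicyProfile.joint ρ) s₁ k)
            (Function.update (σ s₁) k (π' 0 s₁)) := by
          rw [totalValue_succ, htail, expectedPayoff]
          -- The deviator's continuation is bounded by the equilibrium one at every next state; this
          -- is why the induction covers all initial states.
          refine Finset.sum_le_sum fun a _ => ?_
          rw [← hhead]
          refine mul_le_mul_of_nonneg_left (add_le_add_right ?_ _)
            ((PolicyProfile.joint _ 0 s₁).2.1 a)
          exact Finset.sum_le_sum fun s' _ =>
            mul_le_mul_of_nonneg_left (hρ s' k _) ((G.P 0 s₁ a).2.1 s')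
      _ ≤ expectedPayoff (G.stagePayoff (PolicyProfile.joint ρ) s₁ k) (σ s₁) := hσ s₁ k _
      _ = G.totalValue (PolicyProfile.joint π) k s₁ := by
          rw [totalValue_succ]
          rfl

end MOMG

theorem mainTheorem2 {N H M : ℕ} {S : Type*} [Fintype S] {A : Fin N → Type*}
    [∀ i, Fintype (A i)] [∀ i, Nonempty (A i)] (G : MOMG N S A H M) (s₁ : S) :
    ∃ π : PolicyProfile H S A, G.IsPNE s₁ π := by
  obtain ⟨π, hπ⟩ := G.exists_totalValue_equilibrium
  refine ⟨π, fun k ⟨π', hle, j, hlt⟩ => absurd (hπ s₁ k π') (not_le.2 ?_)⟩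
  exact Finset.sum_lt_sum (fun i _ => hle i) ⟨j, Finset.mem_univ j, hlt⟩
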